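/- An overpartition of $m\ge 0$ is a partition of $m$ in which the first occurrence of each part may be overlined. For $n\ge 0$ let $\overline{p}_3(n)$ be the number of triples $(\omega_1,\omega_2,\omega_3)$ of overpartitions (the empty one being allowed) such that the sum of all parts of $\omega_1,\omega_2,\omega_3$ is $n$; in particular $\overline{p}_3(0)=1$. As formal power series in $q$ with integer coefficients, put \[ \varphi(q)=\sum_{m=-\infty}^{\infty}q^{m^2},\qquad (q^k;q^k)_\infty=\prod_{n\ge 1}(1-q^{kn}),\qquad B(q)=\frac{(q;q)_\infty\,(q^6;q^6)_\infty^2}{(q^2;q^2)_\infty\,(q^3;q^3)_\infty}. \] Congruences between power series are understood coefficientwise. (1) We have \[ \begin{aligned} \sum_{n\ge 0}\overline{p}_3(3n)(-q)^n&\equiv \frac{\varphi(q^3)}{\varphi(q)^4}\pmod{9\cdot 2^3},\\ \sum_{n\ge 0}\overline{p}_3(3n+1)(-q)^n&\equiv 6\,\frac{\varphi(q^3)^4}{\varphi(q)^8}\,B(-q)\pmod{9\cdot 2^4},\\ \sum_{n\ge 0}\overline{p}_3(3n+2)(-q)^n&\equiv 24\,\frac{\varphi(q^3)^3}{\varphi(q)^8}\,B(-q)^2\pmod{9\cdot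 2^5}. \end{aligned} \] (2) For every integer $\alpha\ge 1$, \[ \begin{aligned} \sum_{n\ge 0}\overline{p}_3(3^{2\alpha}n)(-q)^n&\equiv \frac{\varphi(q^3)^4}{\varphi(q)^7}\pmod{9\cdot 2^3},\\ \sum_{n\ge 0}\overline{p}_3(3^{2\alpha+1}n)(-q)^n&\equiv \frac{\varphi(q^3)^5}{\varphi(q)^8}\pmod{9\cdot 2^3}. \end{aligned} \] -/

import Mathlib

open PowerSeries

open scoped PowerSeries.WithPiTopology

namespace OverpartitionTriples

/-- An overpartition of `n`: a partition of `n` in which the first occurrence of each part size may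
be overlined.  It is recorded by the underlying partition and the set of those part sizes whose
first occurrence is overlined. -/
@[ext]
structure Overpartition (n : ℕ) where
  toPartition : n.Partition
  overlined : Finset ℕ
  overlined_subset : overlined ⊆ toPartition.parts.toFinset

/-- An overpartition `k`-tuple of `n`: a `k`-tuple `(ω₁, …, ω_k)` of overpartitions, `ωᵢ` being an
overpartition of `dᵢ`, with `d₁ + ⋯ + d_k = n`. -/
def OverpartitionTuple (k n : ℕ) : Type :=
  Σ d : {d : Fin k → ℕ // ∑ i, d i = n}, ∀ i, Overpartition (d.1 i)

/-- `pbar k n` is the number of overpartition `k`-tuples of `n`. -/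
noncomputable def pbar (k n : ℕ) : ℕ := Nat.card (OverpartitionTuple k n)

instance finite_overpartition (n : ℕ) : Finite (Overpartition n) := by
  have h : Function.Injective
      (fun ω : Overpartition n =>
        (⟨ω.toPartition, ω.overlined, Finset.mem_powerset.2 ω.overlined_subset⟩ :
          Σ p : n.Partition, {s : Finset ℕ // s ∈ p.parts.toFinset.powerset})) := by
    rintro ⟨p, s, hs⟩ ⟨p', s', hs'⟩ h
    obtain rfl : p = p' := congrArg Sigma.fst h
    simpa using h
  exact Finite.of_injective _ h

/-- The type of overpartition tuples is finite, so `pbar` is a genuine count. -/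
instance finite_overpartitionTuple (k n : ℕ) : Finite (OverpartitionTuple k n) := by
  have : Finite {d : Fin k → ℕ // ∑ i, d i = n} := by
    have h : Function.Injective
        (fun d : {d : Fin k → ℕ // ∑ i, d i = n} =>
          fun i => (⟨d.1 i, Nat.lt_succ_of_le ((Finset.single_le_sum (f := d.1)
            (fun _ _ => Nat.zero_le _) (Finset.mem_univ i)).trans_eq d.2)⟩ :
            Fin (n + 1))) := by
      intro d d' h
      ext i
      simpa using congrFun h i
    exact Finite.of_injective _ h
  unfold OverpartitionTuple
  infer_instance

/-- Ramanujan's theta function `φ(q) = ∑_{m ∈ ℤ} q^(m²)` as a formal power series: the coefficient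
of `q^n` is the number of integers `m` with `m² = n`. -/
noncomputable def phi : ℤ⟦X⟧ :=
  PowerSeries.mk fun n => (Nat.card {m : ℤ // m ^ 2 = (n : ℤ)} : ℤ)

/-- The infinite product `(q; q)_∞ = ∏_{n ≥ 0} (1 - q^(n+1))`, taken in the topology of
coefficientwise convergence. -/
noncomputable def qProd : ℤ⟦X⟧ := ∏' n : ℕ, (1 - X ^ (n + 1))

/-- The substitution `q ↦ q^k` for `k ≥ 1`: `f(q)` becomes `f(q^k)`. -/
noncomputable def substPow (k : ℕ) (hk : k ≠ 0) (f : ℤ⟦X⟧) : ℤ⟦X⟧ := PowerSeries.expand k hk f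

/-- The substitution `q ↦ -q`: `f(q)` becomes `f(-q)`. -/
noncomputable def substNeg (f : ℤ⟦X⟧) : ℤ⟦X⟧ := PowerSeries.rescale (-1) f

/-- The quotient `f / g` of formal power series, for `g` with constant coefficient `1`. -/
noncomputable def seriesDiv (f g : ℤ⟦X⟧) : ℤ⟦X⟧ := f * PowerSeries.invOfUnit g 1

theorem seriesDiv_mul_cancel (f g : ℤ⟦X⟧) (hg : constantCoeff g = 1) : seriesDiv f g * g = f := by
  rw [seriesDiv, mul_assoc, mul_comm _ g, PowerSeries.mul_invOfUnit g 1 (by simpa using hg), mul_one]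

/-- `B(q) = (q; q)_∞ (q⁶; q⁶)_∞² / ((q²; q²)_∞ (q³; q³)_∞)`. -/
noncomputable def seriesB : ℤ⟦X⟧ :=
  seriesDiv (qProd * substPow 6 (by norm_num) qProd ^ 2)
    (substPow 2 (by norm_num) qProd * substPow 3 (by norm_num) qProd)

/-- Coefficientwise congruence of formal power series modulo `m`. -/
def SeriesModEq (m : ℤ) (f g : ℤ⟦X⟧) : Prop :=
  ∀ n : ℕ, coeff n f ≡ coeff n g [ZMOD m]

/-- The series `∑_{n ≥ 0} a(n) (-q)^n`. -/
noncomputable def altSeries (a : ℕ → ℕ) : ℤ⟦X⟧ :=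
  PowerSeries.mk fun n => (-1) ^ n * (a n : ℤ)

/-- `φ(q)` has constant coefficient `1`, so one may divide by its powers. -/
theorem constantCoeff_phi : constantCoeff phi = 1 := by
  rw [← coeff_zero_eq_constantCoeff_apply, phi, coeff_mk]
  have : Unique {m : ℤ // m ^ 2 = ((0 : ℕ) : ℤ)} :=
    { default := ⟨0, by simp⟩
      uniq := fun ⟨m, hm⟩ => Subtype.ext (by simpa using hm) }
  simp

/-- `(q; q)_∞` has constant coefficient `1`, so one may divide by it. -/
theorem constantCoeff_qProd : constantCoeff qProd = 1 := by
  simp [qProd, (WithPiTopology.multipliable_one_sub_X_pow ℤ).map_tprod _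
    (WithPiTopology.continuous_constantCoeff ℤ)]

/-- The denominator in the definition of `B(q)` has constant coefficient `1`. -/
theorem constantCoeff_denom_seriesB :
    constantCoeff (substPow 2 (by norm_num) qProd * substPow 3 (by norm_num) qProd) = 1 := by
  simp [substPow, PowerSeries.constantCoeff_expand, constantCoeff_qProd]

end OverpartitionTriples

open OverpartitionTriples

namespace OverpartitionTriples

/-! Write v for the overpartition series, A = φ(-q³) and B = B(q). Since v = 1/φ(-q), the series of
`pbar 3` is v³, and everything is proved in q before substituting -q at the end.

The Jacobi triple product (`theta_eq_apProd`) gives B = ∑ (-1)^m q^(3m²+2m). Sorting the squares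
modulo 3 then gives φ(-q) = φ(-q⁹) - 2q B(q³). Multiply this over q, ωq, ω²q with ω a primitive cube
root of unity: the right side becomes φ(-q⁹)³ - 8q³B(q³)³, while the product formula for φ(-q)
evaluates the left side as φ(-q³)⁴/φ(-q⁹). Hence D := A³ - 8qB³ equals φ(-q)⁴/A (`theta_quartic`),
so K := 1/D = A v⁴.

Rationalising the dissection gives v = K(q³)(A² + 2qAB + 4q²B²), with A and B taken at q³
(`overSeries_dissection`). Each section of a power of v used here is thus a power of K times a
polynomial in A, B, q. Modulo the stated modulus this polynomial is a monomial times a power of D,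
which DK = 1 absorbs; the remaining K turn into A v⁴. On multiples of 3, modulo 72, this exchanges
A⁴v⁷ and A⁵v⁸, whence the two families of period two. -/

open Filter Topology

/-! ### Gaussian binomials and the q-binomial theorem -/

section Gauss

variable {R : Type*} [CommRing R]

/-- The Gaussian binomial coefficient with base `Q`. -/
def gaussBinom (Q : R) : ℕ → ℕ → R
  | _, 0 => 1
  | 0, _ + 1 => 0
  | n + 1, k + 1 => gaussBinom Q n k + Q ^ (k + 1) * gaussBinom Q n (k + 1)

theorem gaussBinom_zero_right (Q : R) (n : ℕ) : gaussBinom Q n 0 = 1 := by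
  cases n <;> rfl

theorem gaussBinom_succ_succ (Q : R) (n k : ℕ) :
    gaussBinom Q (n + 1) (k + 1) = gaussBinom Q n k + Q ^ (k + 1) * gaussBinom Q n (k + 1) := rfl

theorem gaussBinom_eq_zero (Q : R) {n k : ℕ} (h : n < k) : gaussBinom Q n k = 0 := by
  induction n generalizing k with
  | zero => obtain ⟨k, rfl⟩ := Nat.exists_eq_add_one_of_ne_zero h.ne'; rfl
  | succ n ih =>
    obtain ⟨k, rfl⟩ := Nat.exists_eq_add_one_of_ne_zero (Nat.ne_zero_of_lt h)
    rw [gaussBinom_succ_succ, ih (by omega), ih (by omega)]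
    simp

/-- The finite product `(Q; Q)_n`. -/
def qFac (Q : R) (n : ℕ) : R := ∏ i ∈ Finset.range n, (1 - Q ^ (i + 1))

theorem qFac_succ (Q : R) (n : ℕ) : qFac Q (n + 1) = qFac Q n * (1 - Q ^ (n + 1)) :=
  Finset.prod_range_succ _ _

theorem gaussBinom_mul_qFac (Q : R) (a b : ℕ) :
    gaussBinom Q (a + b) a * (qFac Q a * qFac Q b) = qFac Q (a + b) := by
  induction h : a + b generalizing a b with
  | zero =>
    obtain ⟨rfl, rfl⟩ : a = 0 ∧ b = 0 := by omega
    simp [gaussBinom_zero_right, qFac]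
  | succ n ih =>
    cases a with
    | zero =>
      obtain rfl : b = n + 1 := by omega
      simp [gaussBinom_zero_right, qFac]
    | succ a =>
      cases b with
      | zero =>
        obtain rfl : a = n := by omega
        have h1 := ih a 0 (by omega)
        rw [gaussBinom_succ_succ, gaussBinom_eq_zero Q (Nat.lt_succ_self a), qFac_succ]
        linear_combination (1 - Q ^ (a + 1)) * h1
      | succ b =>
        have h1 := ih a (b + 1) (by omega)
        have h2 := ih (a + 1) b (by omega)
        obtain rfl : n = a + b + 1 := by omega
        rw [gaussBinom_succ_succ, qFac_succ Q (a + b + 1), ← h1]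
        rw [qFac_succ Q a] at h2 ⊢
        rw [qFac_succ Q b] at h1 ⊢
        linear_combination (1 - Q ^ (b + 1)) * Q ^ (a + 1) * (h2 - h1)

/-- The `q`-binomial theorem, in homogeneous form. -/
theorem prod_add_mul_pow (Q x y : R) (n : ℕ) :
    ∏ j ∈ Finset.range n, (y + x * Q ^ j) =
      ∑ k ∈ Finset.range (n + 1), Q ^ (k.choose 2) * gaussBinom Q n k * x ^ k * y ^ (n - k) := by
  induction n generalizing x with
  | zero => simp [gaussBinom_zero_right]
  | succ n ih =>
    rw [Finset.prod_range_succ']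
    -- With the factor j = 0 split off, the others form the same product at xQ.
    have h : ∀ j, y + x * Q ^ (j + 1) = y + (x * Q) * Q ^ j := fun j => by ring
    simp_rw [h]
    rw [ih, pow_zero, mul_one, mul_add]
    have hy : (∑ k ∈ Finset.range (n + 1),
        Q ^ (k.choose 2) * gaussBinom Q n k * (x * Q) ^ k * y ^ (n - k)) * y =
        (∑ k ∈ Finset.range (n + 1), Q ^ ((k + 1).choose 2) * (Q ^ (k + 1) *
          gaussBinom Q n (k + 1)) * x ^ (k + 1) * y ^ (n - k)) + y ^ (n + 1) := by
      rw [Finset.sum_range_succ', Finset.sum_range_succ]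
      rw [gaussBinom_eq_zero Q (Nat.lt_succ_self n), add_mul, Finset.sum_mul]
      congr 1
      · simp only [mul_zero, zero_mul, add_zero]
        refine Finset.sum_congr rfl fun k hk => ?_
        have hk := Finset.mem_range.1 hk
        obtain ⟨c, rfl⟩ : ∃ c, n = k + 1 + c := ⟨n - (k + 1), by omega⟩
        rw [show k + 1 + c - (k + 1) = c by omega, show k + 1 + c - k = c + 1 by omega]
        ring
      · simp [gaussBinom_zero_right, pow_succ]
    rw [hy, Finset.sum_range_succ' _ (n + 1), add_right_comm, Finset.sum_mul,
      ← Finset.sum_add_distrib]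
    congr 1
    · refine Finset.sum_congr rfl fun k hk => ?_
      rw [gaussBinom_succ_succ, show n + 1 - (k + 1) = n - k by omega]
      have : (k + 1).choose 2 = k.choose 2 + k := by
        rw [Nat.choose_succ_succ' k 1, Nat.choose_one_right, add_comm]
      rw [this]
      ring
    · simp [gaussBinom_zero_right]

end Gauss

/-! ### The Jacobi triple product -/

/-- The exponent `a m² + b m` as a natural number. -/
def thetaExp (a b : ℕ) (m : ℤ) : ℕ := (a * m ^ 2 + b * m).toNat

theorem cast_thetaExp {a b : ℕ} (hab : b < a) (m : ℤ) :
    (thetaExp a b m : ℤ) = a * m ^ 2 + b * m := by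
  rw [thetaExp, Int.toNat_of_nonneg]
  have h1 : (b : ℤ) + 1 ≤ a := by exact_mod_cast hab
  have h2 : |m| ≤ m ^ 2 := by
    simpa using Int.natAbs_le_self_sq m
  nlinarith [neg_abs_le m, abs_nonneg m, sq_nonneg m]

/-- Only the indices |m| ≤ n can contribute to the coefficient of q^n, so finite windows suffice. -/
theorem natAbs_le_thetaExp {a b : ℕ} (hab : b < a) (m : ℤ) : m.natAbs ≤ thetaExp a b m := by
  zify
  rw [cast_thetaExp hab]
  have h1 : (b : ℤ) + 1 ≤ a := by exact_mod_cast hab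
  have h2 : |m| ≤ m ^ 2 := by
    simpa using Int.natAbs_le_self_sq m
  nlinarith [neg_abs_le m, abs_nonneg m, sq_nonneg m]

/-- A finite form of the Jacobi triple product. -/
theorem finite_triple_product {a b : ℕ} (hab : b < a) (N : ℕ) :
    (∏ i ∈ Finset.range N, (1 - (X : ℤ⟦X⟧) ^ (2 * a * i + (a + b)))) *
      ∏ i ∈ Finset.range N, (1 - (X : ℤ⟦X⟧) ^ (2 * a * i + (a - b))) =
    ∑ k ∈ Finset.range (2 * N + 1), (-1) ^ (k + N) * X ^ thetaExp a b ((k : ℤ) - N) *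
      gaussBinom ((X : ℤ⟦X⟧) ^ (2 * a)) (2 * N) k := by
  rcases Nat.eq_zero_or_pos N with rfl | hN
  · simp [gaussBinom_zero_right, thetaExp]
  obtain ⟨M, rfl⟩ : ∃ M, N = M + 1 := ⟨N - 1, by omega⟩
  obtain ⟨c, rfl⟩ : ∃ c, a = b + 1 + c := ⟨a - (b + 1), by omega⟩
  set a := b + 1 + c with ha
  set N := M + 1 with hNM
  -- Y = 2a(N-1) + (a-b). In ∏ (q^Y - q^(2aj)) over j < 2N, the lower half yields the exponents 2ai
  -- + (a-b) and the upper half 2ai + (a+b). The homogeneous form of the q-binomial theorem avoids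
  -- negative powers of q.
  set Y : ℕ := a * (2 * M) + (c + 1) with hY
  have key := prod_add_mul_pow ((X : ℤ⟦X⟧) ^ (2 * a)) (-1) (X ^ Y) (2 * N)
  rw [two_mul N, Finset.prod_range_add, ← Finset.prod_range_reflect] at key
  have h1 : ∀ j ∈ Finset.range N, (X ^ Y + -1 * ((X : ℤ⟦X⟧) ^ (2 * a)) ^ (N - 1 - j)) =
      (-1) * (X ^ (2 * a * (M - j)) * (1 - X ^ (2 * a * j + (a - b)))) := by
    intro j hj
    have hj := Finset.mem_range.1 hj
    obtain ⟨t, rfl⟩ : ∃ t, M = j + t := ⟨M - j, by omega⟩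
    rw [show N - 1 - j = t by omega, show j + t - j = t by omega, show a - b = c + 1 by omega, hY]
    ring
  have h2 : ∀ j ∈ Finset.range N, (X ^ Y + -1 * ((X : ℤ⟦X⟧) ^ (2 * a)) ^ (N + j)) =
      X ^ Y * (1 - X ^ (2 * a * j + (a + b))) := by
    intro j hj
    rw [hY, hNM, ha]
    ring
  rw [Finset.prod_congr rfl h1, Finset.prod_congr rfl h2] at key
  simp only [Finset.prod_mul_distrib, Finset.prod_const, Finset.card_range,
    Finset.prod_pow_eq_pow_sum] at key
  set S := ∑ i ∈ Finset.range N, 2 * a * (M - i) with hS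
  have hSv : S = a * (M * (M + 1)) := by
    rw [hS, ← Finset.mul_sum]
    have := Finset.sum_range_reflect (fun i => i) N
    have h3 : ∑ i ∈ Finset.range N, (M - i) = ∑ i ∈ Finset.range N, i := by
      rw [← this]; simp [hNM]
    rw [h3, mul_comm 2 a, mul_assoc, mul_comm 2, Finset.sum_range_id_mul_two]
    simp [hNM, mul_comm]
  have hX : (X : ℤ⟦X⟧) ^ (S + Y * N) ≠ 0 := pow_ne_zero _ X_ne_zero
  apply mul_left_cancel₀ hX
  have hs : ((-1 : ℤ⟦X⟧) ^ N) * (-1) ^ N = 1 := by rw [← mul_pow]; simp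
  have key2 := congrArg (fun t => (-1 : ℤ⟦X⟧) ^ N * t) key
  rw [Finset.mul_sum] at key2 ⊢
  refine Eq.trans ?_ (key2.trans (Finset.sum_congr (by rw [two_mul]) ?_))
  · rw [pow_add, pow_mul]
    linear_combination (-(X ^ S * (X ^ Y) ^ N *
      (∏ i ∈ Finset.range N, (1 - (X : ℤ⟦X⟧) ^ (2 * a * i + (a + b)))) *
      ∏ i ∈ Finset.range N, (1 - (X : ℤ⟦X⟧) ^ (2 * a * i + (a - b))))) * hs
  · intro k hk
    have hk := Finset.mem_range.1 hk
    rw [← pow_mul, ← pow_mul]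
    -- Completing the square around k = N; the part independent of k is the power of q cancelled
    -- from both sides.
    have hexp : 2 * a * k.choose 2 + Y * (N + N - k) =
        S + Y * N + thetaExp a b ((k : ℤ) - N) := by
      have hc : 2 * k.choose 2 + k = k * k := by
        have := Nat.choose_two_right k
        have h4 : k.choose 2 * 2 = k * (k - 1) := by
          rw [this]; exact Nat.div_mul_cancel (Nat.even_mul_pred_self k).two_dvd
        cases k with
        | zero => rfl
        | succ k => simp at h4 ⊢; nlinarith
      zify [show k ≤ N + N by omega] at hc ⊢
      rw [cast_thetaExp hab, hSv, hY, hNM, ha]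
      push_cast
      linear_combination ((b : ℤ) + 1 + c) * hc
    have : (X : ℤ⟦X⟧) ^ (2 * a * k.choose 2) * X ^ (Y * (N + N - k)) =
        X ^ (S + Y * N) * X ^ (thetaExp a b ((k : ℤ) - N)) := by
      rw [← pow_add, ← pow_add, hexp]
    rw [← two_mul, pow_add] at *
    linear_combination (-1) ^ N * (-1) ^ k * gaussBinom ((X : ℤ⟦X⟧) ^ (2 * a)) (2 * N) k * this

theorem multipliable_one_sub_X_pow_ap {k : ℕ} (hk : 0 < k) (r : ℕ) :
    Multipliable fun n : ℕ => (1 - X ^ (k * n + r) : ℤ⟦X⟧) := by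
  simp_rw [sub_eq_add_neg]
  apply WithPiTopology.multipliable_one_add_of_tendsto_order_atTop_nhds_top
  refine ENat.tendsto_nhds_top_iff_natCast_lt.mpr fun n => eventually_atTop.mpr ⟨n + 1, ?_⟩
  intro m hm
  rw [order_neg, order_X_pow]
  norm_cast
  nlinarith

/-- The product `∏ (1 - q^(kn+r))` over `n ≥ 0`. -/
noncomputable def apProd (k r : ℕ) : ℤ⟦X⟧ := ∏' n : ℕ, (1 - X ^ (k * n + r))

theorem hasProd_apProd {k : ℕ} (hk : 0 < k) (r : ℕ) :
    HasProd (fun n : ℕ => (1 - X ^ (k * n + r) : ℤ⟦X⟧)) (apProd k r) :=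
  (multipliable_one_sub_X_pow_ap hk r).hasProd

theorem tendsto_apProd {k : ℕ} (hk : 0 < k) (r : ℕ) :
    Tendsto (fun N => ∏ n ∈ Finset.range N, (1 - X ^ (k * n + r) : ℤ⟦X⟧)) atTop
      (𝓝 (apProd k r)) :=
  (hasProd_apProd hk r).tendsto_prod_nat

theorem constantCoeff_apProd {k r : ℕ} (hk : 0 < k) (hr : r ≠ 0) :
    constantCoeff (apProd k r) = 1 := by
  rw [apProd, (multipliable_one_sub_X_pow_ap hk r).map_tprod _
    (WithPiTopology.continuous_constantCoeff ℤ)]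
  simp [hr]

theorem isUnit_apProd {k r : ℕ} (hk : 0 < k) (hr : r ≠ 0) : IsUnit (apProd k r) := by
  rw [isUnit_iff_constantCoeff, constantCoeff_apProd hk hr]
  exact isUnit_one

/-- Reduction modulo `q^d`. -/
noncomputable abbrev truncMk (d : ℕ) : ℤ⟦X⟧ →+* ℤ⟦X⟧ ⧸ Ideal.span {(X : ℤ⟦X⟧) ^ d} :=
  Ideal.Quotient.mk _

theorem truncMk_eq_iff {d : ℕ} {f g : ℤ⟦X⟧} :
    truncMk d f = truncMk d g ↔ ∀ n < d, coeff n f = coeff n g := by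
  rw [Ideal.Quotient.eq, Ideal.mem_span_singleton, X_pow_dvd_iff]
  simp [sub_eq_zero]

theorem truncMk_X_pow {d n : ℕ} (h : d ≤ n) : truncMk d (X ^ n) = 0 := by
  rw [← map_zero (truncMk d), truncMk_eq_iff]
  intro m hm
  simp [coeff_X_pow, (hm.trans_le h).ne]

theorem eq_of_truncMk {f g : ℤ⟦X⟧} (h : ∀ d, truncMk d f = truncMk d g) : f = g := by
  ext n
  exact truncMk_eq_iff.1 (h (n + 1)) n n.lt_succ_self

theorem eventually_truncMk_eq {u : ℕ → ℤ⟦X⟧} {f : ℤ⟦X⟧} (h : Tendsto u atTop (𝓝 f)) (d : ℕ) :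
    ∀ᶠ N in atTop, truncMk d (u N) = truncMk d f := by
  simp_rw [truncMk_eq_iff]
  rw [WithPiTopology.tendsto_iff_coeff_tendsto] at h
  have := (eventually_all_finset (Finset.range d)).2
    (fun n _ => tendsto_pure.1 (by simpa only [nhds_discrete] using h n))
  simpa using this

/-- The theta series `∑ (-1)^m q^(a m² + b m)`. -/
noncomputable def theta (a b : ℕ) : ℤ⟦X⟧ :=
  PowerSeries.mk fun n => ∑ m ∈ Finset.Icc (-n : ℤ) n,
    if thetaExp a b m = n then (-1) ^ m.natAbs else 0

theorem coeff_theta {a b : ℕ} (hab : b < a) {n M : ℕ} (h : n ≤ M) :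
    coeff n (theta a b) = ∑ m ∈ Finset.Icc (-M : ℤ) M,
      if thetaExp a b m = n then (-1) ^ m.natAbs else 0 := by
  rw [theta, coeff_mk]
  refine Finset.sum_subset (Finset.Icc_subset_Icc (by omega) (by omega)) fun m _ hm => ?_
  rw [if_neg]
  rintro rfl
  have := natAbs_le_thetaExp hab m
  rw [Finset.mem_Icc] at hm
  omega

theorem truncMk_theta {a b : ℕ} (hab : b < a) {d M : ℕ} (h : d ≤ M) :
    truncMk d (theta a b) =
      truncMk d (∑ m ∈ Finset.Icc (-M : ℤ) M, (-1) ^ m.natAbs * X ^ thetaExp a b m) := by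
  rw [truncMk_eq_iff]
  intro n hn
  rw [coeff_theta hab (hn.le.trans h), map_sum]
  refine Finset.sum_congr rfl fun m _ => ?_
  have : ((-1 : ℤ⟦X⟧) ^ m.natAbs) = C ((-1 : ℤ) ^ m.natAbs) := by simp
  rw [this, coeff_C_mul, coeff_X_pow]
  simp [eq_comm]

/-- The Jacobi triple product identity. -/
theorem theta_eq_apProd {a b : ℕ} (hab : b < a) :
    theta a b = apProd (2 * a) (2 * a) * (apProd (2 * a) (a + b) * apProd (2 * a) (a - b)) := by
  have ha : 0 < 2 * a := by omega
  refine eq_of_truncMk fun d => ?_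
  set E := apProd (2 * a) (2 * a) with hE
  set Q : ℤ⟦X⟧ := X ^ (2 * a) with hQ
  have hq : ∀ n, qFac Q n = ∏ i ∈ Finset.range n, (1 - (X : ℤ⟦X⟧) ^ (2 * a * i + 2 * a)) := by
    intro n
    refine Finset.prod_congr rfl fun i _ => ?_
    rw [hQ]; ring
  obtain ⟨N₀, h₀⟩ := eventually_atTop.1 (eventually_truncMk_eq (tendsto_apProd ha (2 * a)) d)
  obtain ⟨N₁, h₁⟩ := eventually_atTop.1 (eventually_truncMk_eq (tendsto_apProd ha (a + b)) d)
  obtain ⟨N₂, h₂⟩ := eventually_atTop.1 (eventually_truncMk_eq (tendsto_apProd ha (a - b)) d)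
  simp_rw [← hq] at h₀
  -- If |k - N| < d then both k and 2N - k exceed N₀, so every finite product involved has
  -- stabilised modulo q^d.
  set N := N₀ + N₁ + N₂ + d with hN
  have hu : IsUnit (truncMk d E) := (isUnit_apProd ha ha.ne').map _
  have hg : ∀ k ∈ Finset.range (2 * N + 1), truncMk d (E * ((-1) ^ (k + N) *
      X ^ thetaExp a b ((k : ℤ) - N) * gaussBinom Q (2 * N) k)) =
      truncMk d ((-1) ^ ((k : ℤ) - N).natAbs * X ^ thetaExp a b ((k : ℤ) - N)) := by
    intro k hk
    have hk := Finset.mem_range.1 hk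
    have hs : ((-1 : ℤ⟦X⟧)) ^ (k + N) = (-1) ^ ((k : ℤ) - N).natAbs := by
      rw [neg_one_pow_eq_pow_mod_two, neg_one_pow_eq_pow_mod_two (n := Int.natAbs _)]
      congr 1
      omega
    rw [hs]
    -- Near the centre the Gaussian binomial is 1/E modulo q^d; away from it the power of q already
    -- vanishes.
    by_cases hd : ((k : ℤ) - N).natAbs < d
    · obtain ⟨c, hc⟩ : ∃ c, 2 * N = k + c := ⟨2 * N - k, by omega⟩
      have hb := congrArg (truncMk d) (gaussBinom_mul_qFac Q k c)
      rw [map_mul, map_mul, h₀ k (by omega), h₀ c (by omega), h₀ (k + c) (by omega)] at hb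
      have : truncMk d (gaussBinom Q (2 * N) k) * truncMk d E = 1 := by
        apply hu.mul_right_cancel
        rw [hc, ← hE] at *
        linear_combination hb
      simp only [map_mul]
      linear_combination truncMk d ((-1) ^ ((k : ℤ) - N).natAbs) *
        truncMk d (X ^ thetaExp a b ((k : ℤ) - N)) * this
    · have := truncMk_X_pow ((not_lt.1 hd).trans (natAbs_le_thetaExp hab _))
      simp only [map_mul, this]
      ring
  rw [map_mul, map_mul, ← h₁ N (by omega), ← h₂ N (by omega), ← map_mul, ← map_mul,
    finite_triple_product hab, Finset.mul_sum, map_sum, Finset.sum_congr rfl hg,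
    truncMk_theta hab (show d ≤ N by omega), map_sum]
  symm
  refine Finset.sum_nbij' (fun k => (k : ℤ) - N) (fun m => (m + N).toNat) ?_ ?_ ?_ ?_ ?_
  · intro k hk; simp at hk ⊢; omega
  · intro k hk; simp at hk ⊢; omega
  · intro k hk; simp
  · intro k hk; simp at hk ⊢; omega
  · intro k hk; rfl

/-! ### Product formulas for φ(-q) and B(q) -/

theorem continuous_expand {k : ℕ} (hk : k ≠ 0) :
    Continuous (PowerSeries.expand k hk : ℤ⟦X⟧ →ₐ[ℤ] ℤ⟦X⟧) := by
  rw [continuous_iff_continuousAt]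
  intro f
  rw [ContinuousAt, WithPiTopology.tendsto_iff_coeff_tendsto]
  intro d
  by_cases h : k ∣ d
  · obtain ⟨m, rfl⟩ := h
    simp_rw [coeff_expand_mul]
    exact (WithPiTopology.continuous_coeff ℤ m).tendsto f
  · simp_rw [coeff_expand_of_not_dvd k hk _ h]
    exact tendsto_const_nhds

theorem qProd_eq : qProd = apProd 1 1 := by simp [qProd, apProd]

theorem expand_apProd {j k : ℕ} (hj : j ≠ 0) (hk : 0 < k) (r : ℕ) :
    PowerSeries.expand j hj (apProd k r) = apProd (j * k) (j * r) := by
  have := (hasProd_apProd hk r).map (PowerSeries.expand j hj : ℤ⟦X⟧ →ₐ[ℤ] ℤ⟦X⟧)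
    (continuous_expand hj)
  refine this.unique ?_
  convert hasProd_apProd (Nat.mul_pos (Nat.pos_of_ne_zero hj) hk) (j * r) using 2 with n
  simp [← pow_mul]
  ring_nf

theorem substPow_qProd {k : ℕ} (hk : k ≠ 0) : substPow k hk qProd = apProd k k := by
  rw [substPow, qProd_eq, expand_apProd hk one_pos, mul_one]

theorem tendsto_apProd_mul {j k : ℕ} (hj : 0 < j) (hk : 0 < k) (r : ℕ) :
    Tendsto (fun N => ∏ n ∈ Finset.range (j * N), (1 - X ^ (k * n + r) : ℤ⟦X⟧)) atTop
      (𝓝 (apProd k r)) :=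
  (tendsto_apProd hk r).comp (tendsto_id.const_mul_atTop' hj)

theorem apProd_eq_prod_two {k : ℕ} (hk : 0 < k) (r : ℕ) :
    apProd k r = apProd (2 * k) r * apProd (2 * k) (k + r) := by
  refine tendsto_nhds_unique (tendsto_apProd_mul two_pos hk r) ?_
  refine ((tendsto_apProd (Nat.mul_pos two_pos hk) r).mul
    (tendsto_apProd (Nat.mul_pos two_pos hk) (k + r))).congr fun N => ?_
  induction N with
  | zero => simp
  | succ N ih =>
    rw [Finset.prod_range_succ, Finset.prod_range_succ, mul_mul_mul_comm, ih,
      show 2 * (N + 1) = 2 * N + 1 + 1 by ring, Finset.prod_range_succ, Finset.prod_range_succ]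
    ring

theorem apProd_eq_prod_three {k : ℕ} (hk : 0 < k) (r : ℕ) :
    apProd k r = apProd (3 * k) r * apProd (3 * k) (k + r) * apProd (3 * k) (2 * k + r) := by
  refine tendsto_nhds_unique (tendsto_apProd_mul three_pos hk r) ?_
  refine (((tendsto_apProd (Nat.mul_pos three_pos hk) r).mul
    (tendsto_apProd (Nat.mul_pos three_pos hk) (k + r))).mul
    (tendsto_apProd (Nat.mul_pos three_pos hk) (2 * k + r))).congr fun N => ?_
  induction N with
  | zero => simp
  | succ N ih =>
    rw [show 3 * (N + 1) = 3 * N + 1 + 1 + 1 by ring]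
    simp only [Finset.prod_range_succ, ← ih]
    ring

theorem theta_one_zero_mul : theta 1 0 * apProd 2 2 = apProd 1 1 ^ 2 := by
  rw [theta_eq_apProd one_pos, apProd_eq_prod_two one_pos 1]
  norm_num
  ring

/-- The triple product has exponents 0, 1, 5 modulo 6. Splitting all products into classes modulo 6
makes the two sides agree. -/
theorem theta_three_two_mul :
    theta 3 2 * (apProd 2 2 * apProd 3 3) = apProd 1 1 * apProd 6 6 ^ 2 := by
  have h1 := apProd_eq_prod_two one_pos 1
  have h2 := apProd_eq_prod_three two_pos 1
  have h3 := apProd_eq_prod_three two_pos 2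
  have h4 := apProd_eq_prod_two three_pos 3
  norm_num at h1 h2 h3 h4
  rw [theta_eq_apProd (by norm_num), h1, h4, h2, h3]
  norm_num
  ring

theorem seriesB_eq_theta : seriesB = theta 3 2 := by
  have h := seriesDiv_mul_cancel (qProd * substPow 6 (by norm_num) qProd ^ 2) _
    constantCoeff_denom_seriesB
  rw [substPow_qProd, substPow_qProd, substPow_qProd] at h
  have hu : IsUnit (apProd 2 2 * apProd 3 3) :=
    (isUnit_apProd two_pos two_ne_zero).mul (isUnit_apProd three_pos three_ne_zero)
  apply hu.mul_right_cancel
  rw [theta_three_two_mul, seriesB, substPow_qProd, substPow_qProd, substPow_qProd, h, qProd_eq]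

/-! ### The 3-dissection of φ(-q) -/

theorem sum_Icc_neg_succ {A : Type*} [AddCommMonoid A] (f : ℤ → A) (M : ℕ) :
    ∑ m ∈ Finset.Icc (-((M + 1 : ℕ) : ℤ)) ((M + 1 : ℕ) : ℤ), f m =
      (∑ m ∈ Finset.Icc (-(M : ℤ)) M, f m) + f (M + 1) + f (-(M + 1)) := by
  have : Finset.Icc (-((M + 1 : ℕ) : ℤ)) ((M + 1 : ℕ) : ℤ) =
      insert (-((M : ℤ) + 1)) (insert ((M : ℤ) + 1) (Finset.Icc (-(M : ℤ)) M)) := by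
    ext m
    simp only [Finset.mem_Icc, Finset.mem_insert]
    omega
  rw [this, Finset.sum_insert, Finset.sum_insert]
  · rw [add_comm, add_comm (f _)]
  · simp
  · simp only [Finset.mem_Icc, Finset.mem_insert]
    omega

/-- The radius 3M + 1 makes the window a union of complete triples 3m - 1, 3m, 3m + 1. -/
theorem sum_Icc_three_mul {A : Type*} [AddCommMonoid A] (f : ℤ → A) (M : ℕ) :
    ∑ m ∈ Finset.Icc (-((3 * M + 1 : ℕ) : ℤ)) ((3 * M + 1 : ℕ) : ℤ), f m =
      ∑ m ∈ Finset.Icc (-(M : ℤ)) M, (f (3 * m) + f (3 * m + 1) + f (3 * m - 1)) := by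
  induction M with
  | zero =>
    rw [mul_zero, sum_Icc_neg_succ]
    simp
  | succ M ih =>
    rw [sum_Icc_neg_succ _ M, ← ih, show 3 * (M + 1) + 1 = 3 * M + 1 + 1 + 1 + 1 by ring,
      sum_Icc_neg_succ, sum_Icc_neg_succ, sum_Icc_neg_succ]
    push_cast
    ring_nf
    abel

theorem truncMk_expand {d k : ℕ} (hk : k ≠ 0) {f g : ℤ⟦X⟧} (h : truncMk d f = truncMk d g) :
    truncMk d (PowerSeries.expand k hk f) = truncMk d (PowerSeries.expand k hk g) := by
  rw [truncMk_eq_iff] at h ⊢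
  intro n hn
  rw [coeff_expand, coeff_expand, h _ ((Nat.div_le_self n k).trans_lt hn)]

/-- The 3-dissection of `φ(-q)`. -/
theorem theta_one_zero_dissection :
    theta 1 0 = PowerSeries.expand 9 (by norm_num) (theta 1 0) -
      2 * X * PowerSeries.expand 3 (by norm_num) (theta 3 2) := by
  refine eq_of_truncMk fun d => ?_
  rw [map_sub, map_mul, truncMk_expand _ (truncMk_theta one_pos le_rfl),
    truncMk_expand _ (truncMk_theta (show 2 < 3 by norm_num) le_rfl),
    truncMk_theta one_pos (show d ≤ 3 * d + 1 by omega), sum_Icc_three_mul,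
    Finset.sum_add_distrib, Finset.sum_add_distrib, ← map_mul, ← map_sub]
  congr 1
  have h0 : ∀ m : ℤ, (-1 : ℤ⟦X⟧) ^ (3 * m).natAbs * X ^ thetaExp 1 0 (3 * m) =
      PowerSeries.expand 9 (by norm_num) ((-1) ^ m.natAbs * X ^ thetaExp 1 0 m) := by
    intro m
    have he : thetaExp 1 0 (3 * m) = 9 * thetaExp 1 0 m := by
      zify; rw [cast_thetaExp one_pos, cast_thetaExp one_pos]; ring
    rw [he, neg_one_pow_eq_pow_mod_two, neg_one_pow_eq_pow_mod_two (n := m.natAbs)]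
    have : (3 * m).natAbs % 2 = m.natAbs % 2 := by omega
    simp [this, pow_mul]
  have h1 : ∀ m : ℤ, (-1 : ℤ⟦X⟧) ^ (3 * m + 1).natAbs * X ^ thetaExp 1 0 (3 * m + 1) =
      -(X * PowerSeries.expand 3 (by norm_num) ((-1) ^ m.natAbs * X ^ thetaExp 3 2 m)) := by
    intro m
    have he : thetaExp 1 0 (3 * m + 1) = 3 * thetaExp 3 2 m + 1 := by
      zify; rw [cast_thetaExp one_pos, cast_thetaExp (by norm_num)]; push_cast; ring
    have : (3 * m + 1).natAbs % 2 = (m.natAbs + 1) % 2 := by omega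
    rw [he, neg_one_pow_eq_pow_mod_two, this, ← neg_one_pow_eq_pow_mod_two]
    simp only [map_mul, map_pow, map_neg, map_one, expand_X]
    ring
  -- The classes 1 and -1 are exchanged by m ↦ -m, which accounts for the factor 2.
  have h2 : ∀ m : ℤ, (-1 : ℤ⟦X⟧) ^ (3 * m - 1).natAbs * X ^ thetaExp 1 0 (3 * m - 1) =
      (-1 : ℤ⟦X⟧) ^ (3 * (-m) + 1).natAbs * X ^ thetaExp 1 0 (3 * (-m) + 1) := by
    intro m
    have he : thetaExp 1 0 (3 * m - 1) = thetaExp 1 0 (3 * (-m) + 1) := by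
      zify; rw [cast_thetaExp one_pos, cast_thetaExp one_pos]; push_cast; ring
    rw [he]
    congr 2
    omega
  simp_rw [h2]
  have h3 : ∀ f : ℤ → ℤ⟦X⟧, ∑ m ∈ Finset.Icc (-(d : ℤ)) d, f (-m) =
      ∑ m ∈ Finset.Icc (-(d : ℤ)) d, f m := by
    intro f
    refine Finset.sum_nbij' (fun m => -m) (fun m => -m) ?_ ?_ ?_ ?_ ?_ <;>
      intro m hm <;> simp at hm ⊢ <;> omega
  rw [h3 fun m => (-1 : ℤ⟦X⟧) ^ (3 * m + 1).natAbs * X ^ thetaExp 1 0 (3 * m + 1)]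
  simp_rw [h0, h1]
  rw [Finset.sum_neg_distrib, ← Finset.mul_sum, map_sum, map_sum]
  ring

/-! ### The cubic norm and the quartic identity -/

/-- The ring homomorphism `f(q) ↦ f(w q)` into complex power series. -/
noncomputable def twist (w : ℂ) : ℤ⟦X⟧ →+* ℂ⟦X⟧ :=
  (rescale w).comp (PowerSeries.map (Int.castRingHom ℂ))

theorem coeff_twist (w : ℂ) (f : ℤ⟦X⟧) (n : ℕ) :
    coeff n (twist w f) = w ^ n * (coeff n f : ℤ) := by
  simp [twist, coeff_rescale]

theorem continuous_twist (w : ℂ) : Continuous (twist w) := by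
  rw [continuous_iff_continuousAt]
  intro f
  rw [ContinuousAt, WithPiTopology.tendsto_iff_coeff_tendsto]
  intro d
  simp_rw [coeff_twist]
  exact ((continuous_const.mul ((continuous_of_discreteTopology (f := fun z : ℤ => (z : ℂ))).comp
    (WithPiTopology.continuous_coeff ℤ d))).tendsto f)

theorem twist_one_injective : Function.Injective (twist 1) := by
  intro f g h
  ext n
  have := congrArg (coeff n) h
  simpa [coeff_twist] using this

theorem twist_X (w : ℂ) : twist w X = C w * X := by
  ext n
  rw [coeff_twist, coeff_C_mul, coeff_X, coeff_X]
  split_ifs with h <;> simp [h]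

theorem twist_expand_three {w : ℂ} (hw : w ^ 3 = 1) (f : ℤ⟦X⟧) :
    twist w (PowerSeries.expand 3 (by norm_num) f) =
      twist 1 (PowerSeries.expand 3 (by norm_num) f) := by
  ext n
  rw [coeff_twist, coeff_twist, coeff_expand]
  split_ifs with h
  · obtain ⟨m, rfl⟩ := h
    rw [pow_mul, hw]
    simp
  · simp

/-- The norm `f(q) f(ωq) f(ω²q)`. -/
noncomputable def cubicNorm (w : ℂ) (f : ℤ⟦X⟧) : ℂ⟦X⟧ := twist 1 f * twist w f * twist (w ^ 2) f

theorem cubicNorm_mul (w : ℂ) (f g : ℤ⟦X⟧) :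
    cubicNorm w (f * g) = cubicNorm w f * cubicNorm w g := by
  simp only [cubicNorm, map_mul]; ring

/-- As e is prime to 3, the e-th power permutes the cube roots of unity, and (1 - Y)(1 - ωY)(1 -
ω²Y) = 1 - Y³. -/
theorem cubicNorm_one_sub_X_pow {w : ℂ} (hw : w ^ 2 + w + 1 = 0) {e : ℕ} (he : ¬ 3 ∣ e) :
    cubicNorm w (1 - X ^ e) = twist 1 (1 - X ^ (3 * e)) := by
  have h3 : w ^ 3 = 1 := by linear_combination (w - 1) * hw
  have hC : (C w : ℂ⟦X⟧) ^ 2 + C w + 1 = 0 := by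
    rw [← map_pow, ← map_add, ← map_one C, ← map_add, hw, map_zero]
  have hC3 : (C w : ℂ⟦X⟧) ^ 3 = 1 := by rw [← map_pow, h3, map_one]
  obtain ⟨t, r, hr, rfl⟩ : ∃ t r, (r = 1 ∨ r = 2) ∧ e = 3 * t + r :=
    ⟨e / 3, e % 3, by omega, by omega⟩
  have ht : ∀ s : ℕ, (C w : ℂ⟦X⟧) ^ (3 * s) = 1 := fun s => by rw [pow_mul, hC3, one_pow]
  simp only [cubicNorm, map_sub, map_one, map_pow, twist_X, mul_pow, one_mul]
  have e1 : (C w : ℂ⟦X⟧) ^ (3 * t + r) = C w ^ r := by rw [pow_add, ht, one_mul]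
  have e2 : ((C w : ℂ⟦X⟧) ^ 2) ^ (3 * t + r) = C w ^ (2 * r) := by
    rw [← pow_mul, show 2 * (3 * t + r) = 3 * (2 * t) + 2 * r by ring, pow_add, ht, one_mul]
  rw [e1, e2, mul_comm 3 (3 * t + r), pow_mul (X : ℂ⟦X⟧) _ 3]
  generalize (X : ℂ⟦X⟧) ^ (3 * t + r) = Y
  generalize C w = c at *
  rcases hr with rfl | rfl
  · linear_combination (-Y + Y ^ 2 * c - Y ^ 3 * (c - 1)) * hC
  · linear_combination (-Y * (c ^ 2 - c + 1) + Y ^ 2 * (c ^ 4 - c ^ 3 + c ^ 2) -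
      Y ^ 3 * (c ^ 3 + 1) * (c - 1)) * hC

theorem cubicNorm_one_sub_X_pow_three_mul {w : ℂ} (hw : w ^ 3 = 1) (e : ℕ) :
    cubicNorm w (1 - X ^ (3 * e)) = twist 1 ((1 - X ^ (3 * e)) ^ 3) := by
  have hX : (1 - X ^ (3 * e) : ℤ⟦X⟧) = PowerSeries.expand 3 (by norm_num) (1 - X ^ e) := by
    simp [pow_mul]
  have h6 : (w ^ 2) ^ 3 = 1 := by rw [← pow_mul, mul_comm, pow_mul, hw, one_pow]
  rw [cubicNorm, hX, twist_expand_three hw, twist_expand_three h6, map_pow]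
  ring

/-- Factors with exponent e prime to 3 have norm 1 - q^(3e); the others are merely cubed. The first
kind gives (q^(3k))_∞/(q^(9k))_∞, the second (q^(3k))_∞³. Grouping factors by threes makes this
exact at each finite stage. -/
theorem cubicNorm_apProd {w : ℂ} (hw : w ^ 2 + w + 1 = 0) {k : ℕ} (hk : ¬ 3 ∣ k) :
    cubicNorm w (apProd k k) * twist 1 (apProd (9 * k) (9 * k)) =
      twist 1 (apProd (3 * k) (3 * k)) ^ 4 := by
  have h3 : w ^ 3 = 1 := by linear_combination (w - 1) * hw
  have k0 : 0 < k := by omega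
  have tw : ∀ v : ℂ, Tendsto (fun N => twist v (∏ n ∈ Finset.range (3 * N),
      (1 - X ^ (k * n + k)))) atTop (𝓝 (twist v (apProd k k))) := fun v =>
    ((continuous_twist v).tendsto _).comp (tendsto_apProd_mul three_pos k0 k)
  have t9 := ((continuous_twist 1).tendsto _).comp
    (tendsto_apProd (show 0 < 9 * k by omega) (9 * k))
  have t3 := ((continuous_twist 1).tendsto _).comp
    (tendsto_apProd (show 0 < 3 * k by omega) (3 * k))
  have t3' := ((continuous_twist 1).tendsto _).comp
    (tendsto_apProd_mul three_pos (show 0 < 3 * k by omega) (3 * k))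
  have hl := (((tw 1).mul (tw w)).mul (tw (w ^ 2))).mul t9
  have hr := t3'.mul (t3.pow 3)
  rw [show twist 1 (apProd (3 * k) (3 * k)) ^ 4 = twist 1 (apProd (3 * k) (3 * k)) *
    twist 1 (apProd (3 * k) (3 * k)) ^ 3 by ring]
  refine tendsto_nhds_unique hl (hr.congr fun N => ?_)
  change _ = cubicNorm w _ * twist 1 _
  simp only [Function.comp]
  induction N with
  | zero => simp [cubicNorm]
  | succ N ih =>
    rw [show 3 * (N + 1) = 3 * N + 1 + 1 + 1 by ring]
    simp only [Finset.prod_range_succ, cubicNorm_mul]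
    rw [cubicNorm_one_sub_X_pow hw (e := k * (3 * N) + k),
      cubicNorm_one_sub_X_pow hw (e := k * (3 * N + 1) + k),
      show k * (3 * N + 1 + 1) + k = 3 * (k * N + k) by ring,
      cubicNorm_one_sub_X_pow_three_mul h3]
    · simp only [map_mul, map_pow] at ih ⊢
      rw [show 3 * k * (3 * N) + 3 * k = 3 * (k * (3 * N) + k) by ring,
        show 3 * k * (3 * N + 1) + 3 * k = 3 * (k * (3 * N + 1) + k) by ring,
        show 3 * k * (3 * N + 1 + 1) + 3 * k = 9 * k * N + 9 * k by ring,
        show 3 * k * N + 3 * k = 3 * (k * N + k) by ring]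
      linear_combination ih * (twist 1 (1 - X ^ (3 * (k * (3 * N) + k)))) *
        (twist 1 (1 - X ^ (3 * (k * (3 * N + 1) + k)))) * (twist 1 (1 - X ^ (9 * k * N + 9 * k))) *
        twist 1 (1 - X ^ (3 * (k * N + k))) ^ 3
    · rintro ⟨c, hc⟩
      rcases (show k % 3 = 1 ∨ k % 3 = 2 by omega) with h | h
      all_goals
        have : (k * (3 * N + 1) + k) = 3 * (k * N) + 2 * k := by ring
        omega
    · rintro ⟨c, hc⟩
      have : (k * (3 * N) + k) = 3 * (k * N) + k := by ring
      omega

theorem expand_injective {k : ℕ} (hk : k ≠ 0) :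
    Function.Injective (PowerSeries.expand k hk : ℤ⟦X⟧ →ₐ[ℤ] ℤ⟦X⟧) := by
  intro f g h
  ext n
  simpa [coeff_expand_mul] using congrArg (coeff (k * n)) h

theorem exists_primitive_cube_root : ∃ w : ℂ, w ^ 2 + w + 1 = 0 := by
  have := IsAlgClosed.exists_eq_mul_self (-3 : ℂ)
  obtain ⟨z, hz⟩ := this
  exact ⟨(z - 1) / 2, by linear_combination -hz / 4⟩

/-- `(φ(-q³)³ - 8 q B(q)³) φ(-q³) = φ(-q)⁴`. -/
theorem theta_quartic :
    (PowerSeries.expand 3 (by norm_num) (theta 1 0) ^ 3 - 8 * X * theta 3 2 ^ 3) *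
      PowerSeries.expand 3 (by norm_num) (theta 1 0) = theta 1 0 ^ 4 := by
  obtain ⟨w, hw⟩ := exists_primitive_cube_root
  have h3 : w ^ 3 = 1 := by linear_combination (w - 1) * hw
  have h6 : (w ^ 2) ^ 3 = 1 := by rw [← pow_mul, mul_comm, pow_mul, h3, one_pow]
  -- Norms are series in q³, so the identity is checked after q ↦ q³ and inside ℂ⟦X⟧.
  apply expand_injective (show 3 ≠ 0 by norm_num)
  apply twist_one_injective
  have hC : (C w : ℂ⟦X⟧) ^ 2 + C w + 1 = 0 := by
    rw [← map_pow, ← map_add, ← map_one C, ← map_add, hw, map_zero]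
  have h99 : PowerSeries.expand 9 (by norm_num) (theta 1 0) = PowerSeries.expand 3 (by norm_num)
      (PowerSeries.expand 3 (by norm_num) (theta 1 0)) := by
    rw [← expand_mul]
  have hn : cubicNorm w (theta 1 0) = twist 1 (PowerSeries.expand 3 (by norm_num)
      (PowerSeries.expand 3 (by norm_num) (theta 1 0) ^ 3 - 8 * X * theta 3 2 ^ 3)) := by
    have hd : ∀ v : ℂ, v ^ 3 = 1 → twist v (theta 1 0) =
        twist 1 (PowerSeries.expand 3 (by norm_num) (PowerSeries.expand 3 (by norm_num)
          (theta 1 0))) -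
        2 * (C v * X) * twist 1 (PowerSeries.expand 3 (by norm_num) (theta 3 2)) := by
      intro v hv
      have := congrArg (twist v) theta_one_zero_dissection
      rw [h99] at this
      simpa only [map_sub, map_mul, map_ofNat, twist_X, twist_expand_three hv] using this
    rw [cubicNorm, hd 1 (one_pow 3), hd w h3, hd (w ^ 2) h6]
    simp only [map_sub, map_mul, map_pow, expand_X, twist_X, map_ofNat, map_one, one_mul]
    generalize twist 1 _ = A
    generalize twist 1 _ = B
    generalize C w = c at *
    linear_combination (-2 * A ^ 2 * X * B + 4 * A * X ^ 2 * B ^ 2 * c -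
      8 * X ^ 3 * B ^ 3 * (c - 1)) * hC
  have hE1 := cubicNorm_apProd hw (k := 1) (by norm_num)
  have hE2 := cubicNorm_apProd hw (k := 2) (by norm_num)
  have hg := congrArg (cubicNorm w) theta_one_zero_mul
  have hg3 := congrArg (fun f => twist 1 (PowerSeries.expand 3 (by norm_num) f)) theta_one_zero_mul
  have hg9 := congrArg (fun f => twist 1 (PowerSeries.expand 9 (by norm_num) f)) theta_one_zero_mul
  rw [pow_two, cubicNorm_mul, cubicNorm_mul] at hg
  simp only [map_mul, map_pow, expand_apProd _ one_pos, expand_apProd _ two_pos] at hg3 hg9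
  norm_num at hE1 hE2 hg3 hg9
  have hu : twist 1 (apProd 6 6) ^ 4 * twist 1 (apProd 18 18) ≠ 0 := by
    have hi : ∀ k, 0 < k → twist 1 (apProd k k) ≠ 0 := fun k hk =>
      ((isUnit_apProd hk hk.ne').map (twist 1)).ne_zero
    exact mul_ne_zero (pow_ne_zero _ (hi 6 (by norm_num))) (hi 18 (by norm_num))
  rw [map_mul, map_mul, ← hn, ← h99]
  apply mul_right_cancel₀ hu
  rw [map_pow, map_pow]
  -- Here n, n1, n2 are the norms of φ(-q), (q)_∞, (q²)_∞, the e's are the products at q³, q⁶, q⁹,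
  -- q¹⁸, and g3, g9 are φ(-q³), φ(-q⁹). Cleared of denominators, n = n1²/n2 = g3⁴/g9.
  have alg : ∀ n n1 n2 e3 e6 e9 e18 g3 g9 : ℂ⟦X⟧, n * n2 = n1 * n1 → n1 * e9 = e3 ^ 4 →
      n2 * e18 = e6 ^ 4 → g3 * e6 = e3 ^ 2 → g9 * e18 = e9 ^ 2 →
      n * g9 * (e6 ^ 4 * e18) = g3 ^ 4 * (e6 ^ 4 * e18) := by
    intro n n1 n2 e3 e6 e9 e18 g3 g9 h1 h2 h3 h4 h5
    linear_combination n * e6 ^ 4 * h5 - n * e9 ^ 2 * h3 + e9 ^ 2 * e18 * h1 +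
      e18 * (n1 * e9 + e3 ^ 4) * h2 -
      e18 * (g3 * e6 + e3 ^ 2) * ((g3 * e6) ^ 2 + e3 ^ 4) * h4
  exact alg _ _ _ _ _ _ _ _ _ hg hE1 hE2 hg3 hg9

/-! ### Generating functions of overpartitions and their tuples -/

/-- An overpartition is a partition with a subset of its set of parts. -/
def overpartitionEquiv (n : ℕ) :
    Overpartition n ≃ Σ p : n.Partition, {s : Finset ℕ // s ∈ p.parts.toFinset.powerset} where
  toFun ω := ⟨ω.toPartition, ω.overlined, Finset.mem_powerset.2 ω.overlined_subset⟩
  invFun x := ⟨x.1, x.2.1, Finset.mem_powerset.1 x.2.2⟩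
  left_inv _ := rfl
  right_inv _ := rfl

theorem card_overpartition (n : ℕ) :
    Nat.card (Overpartition n) = ∑ p : n.Partition, 2 ^ p.parts.toFinset.card := by
  rw [Nat.card_congr (overpartitionEquiv n), Nat.card_sigma]
  refine Finset.sum_congr rfl fun p _ => ?_
  rw [Nat.card_eq_fintype_card, Fintype.card_coe, Finset.card_powerset]

/-- The generating function of overpartitions. -/
noncomputable def overSeries : ℤ⟦X⟧ := PowerSeries.mk fun n => (Nat.card (Overpartition n) : ℤ)

theorem overSeries_eq_genFun : overSeries = Nat.Partition.genFun fun _ _ => (2 : ℤ) := by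
  ext n
  rw [overSeries, coeff_mk, Nat.Partition.coeff_genFun, card_overpartition]
  push_cast
  refine Finset.sum_congr rfl fun p _ => ?_
  rw [Finsupp.prod, Finset.prod_const, Multiset.toFinsupp_support]

theorem overSeries_mul : overSeries * apProd 1 1 ^ 2 = apProd 2 2 := by
  have h1 := hasProd_apProd one_pos 1
  have h2 := hasProd_apProd two_pos 2
  have h := ((Nat.Partition.hasProd_genFun fun _ _ => (2 : ℤ)).mul h1).mul h1
  rw [← overSeries_eq_genFun] at h
  rw [pow_two, ← mul_assoc]
  refine h.unique ?_
  -- A part size used at least once has two states, so its factor is 1 + 2∑ Y^j = (1 + Y)/(1 - Y),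
  -- summed over j ≥ 1, with Y = q^(i+1).
  have hf : ∀ i : ℕ, (1 + ∑' j : ℕ, (2 : ℤ) • (X : ℤ⟦X⟧) ^ ((i + 1) * (j + 1))) *
      (1 - X ^ (1 * i + 1)) * (1 - X ^ (1 * i + 1)) = 1 - X ^ (2 * i + 2) := by
    intro i
    have hs := WithPiTopology.one_sub_mul_tsum_pow_of_constantCoeff_eq_zero (R := ℤ)
      (f := X ^ (i + 1)) (by simp)
    have hm := WithPiTopology.summable_pow_of_constantCoeff_eq_zero (R := ℤ)
      (f := X ^ (i + 1)) (by simp)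
    have ht : ∑' j : ℕ, (2 : ℤ) • (X : ℤ⟦X⟧) ^ ((i + 1) * (j + 1)) =
        2 * X ^ (i + 1) * ∑' j : ℕ, ((X : ℤ⟦X⟧) ^ (i + 1)) ^ j := by
      rw [← hm.tsum_mul_left]
      refine tsum_congr fun j => ?_
      rw [zsmul_eq_mul]
      push_cast
      ring
    rw [ht]
    generalize ∑' j : ℕ, ((X : ℤ⟦X⟧) ^ (i + 1)) ^ j = T at *
    rw [show 2 * i + 2 = (i + 1) * 2 by ring, pow_mul, one_mul]
    linear_combination 2 * (X : ℤ⟦X⟧) ^ (i + 1) * (1 - X ^ (i + 1)) * hs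
  exact (congrArg (fun F : ℕ → ℤ⟦X⟧ => HasProd F (apProd 2 2)) (funext hf)).mpr h2

theorem overSeries_mul_theta : overSeries * theta 1 0 = 1 := by
  have hu : IsUnit (apProd 2 2) := isUnit_apProd two_pos two_ne_zero
  apply hu.mul_right_cancel
  rw [mul_assoc, theta_one_zero_mul, overSeries_mul, one_mul]

theorem mk_pbar_eq (k : ℕ) : PowerSeries.mk (fun n => (pbar k n : ℤ)) = overSeries ^ k := by
  ext n
  have hp : overSeries ^ k = ∏ _i : Fin k, overSeries := by simp
  rw [coeff_mk, hp, coeff_prod, pbar, OverpartitionTuple]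
  have : Fintype {d : Fin k → ℕ // ∑ i, d i = n} :=
    Fintype.subtype (Finset.piAntidiag Finset.univ n) (by simp)
  rw [Nat.card_sigma]
  push_cast
  simp_rw [Nat.card_pi]
  rw [← Finset.sum_coe_sort (Finset.finsuppAntidiag _ _)]
  refine Fintype.sum_equiv
    (Finsupp.equivFunOnFinite.symm.subtypeEquiv (by
      intro d
      simp [Finset.mem_finsuppAntidiag])) _ _ ?_
  intro d
  simp [overSeries]

theorem substNeg_theta : substNeg (theta 1 0) = phi := by
  ext n
  rw [substNeg, coeff_rescale, phi, coeff_mk, theta, coeff_mk]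
  have hset : {m : ℤ | m ^ 2 = n} =
      ((Finset.Icc (-n : ℤ) n).filter fun m => m ^ 2 = n : Finset ℤ) := by
    ext m
    simp only [Set.mem_ofPred_eq, Finset.coe_filter, Finset.mem_Icc]
    refine ⟨fun h => ⟨?_, h⟩, fun h => h.2⟩
    have := Int.natAbs_le_self_sq m
    omega
  have hc : Nat.card {m : ℤ // m ^ 2 = (n : ℤ)} =
      ((Finset.Icc (-n : ℤ) n).filter fun m => m ^ 2 = (n : ℤ)).card := by
    rw [← Set.ncard_coe_finset, ← hset]
    rfl
  rw [hc, Finset.card_filter, Finset.mul_sum]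
  push_cast
  refine Finset.sum_congr rfl fun m _ => ?_
  have he : thetaExp 1 0 m = n ↔ m ^ 2 = n := by
    zify; rw [cast_thetaExp one_pos]; simp
  rw [if_congr he rfl rfl]
  split_ifs with h
  -- The signs cancel because n = m² has the parity of m.
  · rw [← pow_add, Even.neg_one_pow]
    have h2 : (n : ℤ) = (m.natAbs : ℤ) ^ 2 := by simp [h]
    have h3 : n = m.natAbs ^ 2 := by exact_mod_cast h2
    rw [h3, pow_two, ← Nat.mul_succ]
    exact Nat.even_mul_succ_self _
  · simp

theorem substNeg_expand_three (f : ℤ⟦X⟧) :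
    substNeg (PowerSeries.expand 3 (by norm_num) f) =
      substPow 3 three_ne_zero (substNeg f) := by
  ext n
  rw [substNeg, coeff_rescale, substPow, coeff_expand, coeff_expand]
  split_ifs with h
  · obtain ⟨m, rfl⟩ := h
    rw [substNeg, coeff_rescale, pow_mul]
    simp
  · simp

/-! ### Sections modulo 3 of powers of 1/φ(-q) -/

/-- The section `∑ a(3n+r) q^n` of `∑ a(n) q^n`. -/
noncomputable def tri (r : ℕ) : ℤ⟦X⟧ →+ ℤ⟦X⟧ where
  toFun f := PowerSeries.mk fun n => coeff (3 * n + r) f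
  map_zero' := by ext; simp
  map_add' f g := by ext; simp

theorem coeff_tri (r : ℕ) (f : ℤ⟦X⟧) (n : ℕ) : coeff n (tri r f) = coeff (3 * n + r) f := by
  simp [tri]

/-- A 3-dissection is unique, so the sections of a power of v can be read off from an explicit
polynomial expansion. -/
theorem tri_sum {f a b c : ℤ⟦X⟧} (h : f = PowerSeries.expand 3 (by norm_num) a +
    X * PowerSeries.expand 3 (by norm_num) b + X ^ 2 * PowerSeries.expand 3 (by norm_num) c) :
    tri 0 f = a ∧ tri 1 f = b ∧ tri 2 f = c := by
  subst h
  have hz : ∀ (g : ℤ⟦X⟧) (n r : ℕ), r = 1 ∨ r = 2 →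
      coeff (3 * n + r) (PowerSeries.expand 3 (by norm_num) g) = 0 := fun g n r hr =>
    coeff_expand_of_not_dvd 3 (by norm_num) g (by omega)
  have h0 : ∀ (g : ℤ⟦X⟧) (n : ℕ),
      coeff (3 * n) (PowerSeries.expand 3 (by norm_num) g) = coeff n g := fun g n =>
    coeff_expand_mul 3 (by norm_num) g n
  refine ⟨?_, ?_, ?_⟩ <;> ext n <;> rw [coeff_tri, map_add, map_add, mul_comm X, mul_comm (X ^ 2)]
  · rw [add_zero, h0]
    cases n with
    | zero => simp
    | succ n =>
      rw [show 3 * (n + 1) = 3 * n + 2 + 1 by ring, coeff_succ_mul_X,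
        show 3 * n + 2 + 1 = 3 * n + 1 + 2 by ring, coeff_mul_X_pow, hz _ _ _ (Or.inr rfl),
        hz _ _ _ (Or.inl rfl)]
      simp
  · rw [coeff_succ_mul_X, h0, hz _ _ _ (Or.inl rfl)]
    cases n with
    | zero => simp [coeff_mul_X_pow']
    | succ n =>
      rw [show 3 * (n + 1) + 1 = 3 * n + 2 + 2 by ring, coeff_mul_X_pow, hz _ _ _ (Or.inr rfl)]
      simp
  · rw [coeff_mul_X_pow, h0, hz _ _ _ (Or.inr rfl), show 3 * n + 2 = 3 * n + 1 + 1 by ring,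
      coeff_succ_mul_X, hz _ _ _ (Or.inl rfl)]
    simp

/-- `φ(-q³)/φ(-q)⁴`. -/
noncomputable def cubicQuot : ℤ⟦X⟧ :=
  PowerSeries.expand 3 (by norm_num) (theta 1 0) * overSeries ^ 4

theorem disc_mul_cubicQuot :
    (PowerSeries.expand 3 (by norm_num) (theta 1 0) ^ 3 - 8 * X * theta 3 2 ^ 3) *
      cubicQuot = 1 := by
  have h := theta_quartic
  have hv := overSeries_mul_theta
  rw [cubicQuot, ← mul_assoc, h, ← mul_pow, mul_comm, hv, one_pow]

/-- The 3-dissection of `1/φ(-q)`. -/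
theorem overSeries_dissection :
    overSeries = PowerSeries.expand 3 (by norm_num) cubicQuot *
      (PowerSeries.expand 3 (by norm_num) (PowerSeries.expand 3 (by norm_num) (theta 1 0)) ^ 2 +
        2 * X * PowerSeries.expand 3 (by norm_num) (PowerSeries.expand 3 (by norm_num) (theta 1
          0)) *
          PowerSeries.expand 3 (by norm_num) (theta 3 2) +
        4 * X ^ 2 * PowerSeries.expand 3 (by norm_num) (theta 3 2) ^ 2) := by
  have h := congrArg (PowerSeries.expand 3 (by norm_num)) disc_mul_cubicQuot
  have hv := overSeries_mul_theta
  have hd := theta_one_zero_dissection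
  have h99 : PowerSeries.expand 9 (by norm_num) (theta 1 0) = PowerSeries.expand 3 (by norm_num)
      (PowerSeries.expand 3 (by norm_num) (theta 1 0)) := by
    rw [← expand_mul]
  rw [h99] at hd
  simp only [map_sub, map_mul, map_pow, map_ofNat, map_one, expand_X] at h
  generalize PowerSeries.expand 3 _ (PowerSeries.expand 3 _ (theta 1 0)) = P at *
  generalize PowerSeries.expand 3 _ (theta 3 2) = Q at *
  generalize PowerSeries.expand 3 _ cubicQuot = K at *
  -- Rationalisation: (P - 2XQ)(P² + 2XPQ + 4X²Q²) = P³ - 8X³Q³, whose inverse is K.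
  linear_combination (-overSeries) * h + K * (P ^ 2 + 2 * X * P * Q + 4 * X ^ 2 * Q ^ 2) * hv -
    overSeries * K * (P ^ 2 + 2 * X * P * Q + 4 * X ^ 2 * Q ^ 2) * hd

theorem tri_overSeries_pow_three {A B : ℤ⟦X⟧}
    (hA : A = PowerSeries.expand 3 (by norm_num) (theta 1 0)) (hB : B = theta 3 2) (c : ℤ⟦X⟧) :
    tri 0 (PowerSeries.expand 3 (by norm_num) c * overSeries ^ 3) =
      c * cubicQuot ^ 3 * (A ^ 6 + 56 * A ^ 3 * B ^ 3 * X + 64 * B ^ 6 * X ^ 2) ∧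
    tri 1 (PowerSeries.expand 3 (by norm_num) c * overSeries ^ 3) =
      c * cubicQuot ^ 3 * (6 * A ^ 5 * B + 96 * A ^ 2 * B ^ 4 * X) ∧
    tri 2 (PowerSeries.expand 3 (by norm_num) c * overSeries ^ 3) =
      c * cubicQuot ^ 3 * (24 * A ^ 4 * B ^ 2 + 96 * A * B ^ 5 * X) := by
  refine tri_sum ?_
  rw [overSeries_dissection, ← hA, ← hB]
  simp only [map_add, map_mul, map_pow, map_ofNat, expand_X]
  ring

/-- The cofactor c(q³) is needed since K = A v⁴ and the later quotients carry powers of A = φ(-q³),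
which pass through the section as powers of φ(-q). -/
theorem tri_overSeries_pow_four {A B : ℤ⟦X⟧}
    (hA : A = PowerSeries.expand 3 (by norm_num) (theta 1 0)) (hB : B = theta 3 2) (c : ℤ⟦X⟧) :
    tri 0 (PowerSeries.expand 3 (by norm_num) c * overSeries ^ 4) =
      c * cubicQuot ^ 4 * (A ^ 8 + 128 * A ^ 5 * B ^ 3 * X + 640 * A ^ 2 * B ^ 6 * X ^ 2) := by
  refine (tri_sum
    (b := c * cubicQuot ^ 4 * (8 * A ^ 7 * B + 304 * A ^ 4 * B ^ 4 * X + 512 * A * B ^ 7 * X ^ 2))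
    (c := c * cubicQuot ^ 4 * (40 * A ^ 6 * B ^ 2 + 512 * A ^ 3 * B ^ 5 * X + 256 * B ^ 8 * X ^
      2)) ?_).1
  rw [overSeries_dissection, ← hA, ← hB]
  simp only [map_add, map_mul, map_pow, map_ofNat, expand_X]
  ring

theorem tri_overSeries_pow_seven {A B : ℤ⟦X⟧}
    (hA : A = PowerSeries.expand 3 (by norm_num) (theta 1 0)) (hB : B = theta 3 2) (c : ℤ⟦X⟧) :
    tri 0 (PowerSeries.expand 3 (by norm_num) c * overSeries ^ 7) =
      c * cubicQuot ^ 7 * (A ^ 14 + 616 * A ^ 11 * B ^ 3 * X + 22848 * A ^ 8 * B ^ 6 * X ^ 2 +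
        136192 * A ^ 5 * B ^ 9 * X ^ 3 + 114688 * A ^ 2 * B ^ 12 * X ^ 4) := by
  refine (tri_sum
    (b := c * cubicQuot ^ 7 * (14 * A ^ 13 * B + 2576 * A ^ 10 * B ^ 4 * X + 50304 * A ^ 7 * B ^ 7
      * X ^ 2 + 164864 * A ^ 4 * B ^ 10 * X ^ 3 + 57344 * A * B ^ 13 * X ^ 4))
    (c := c * cubicQuot ^ 7 * (112 * A ^ 12 * B ^ 2 + 8512 * A ^ 9 * B ^ 5 * X + 91392 * A ^ 6 * B
      ^ 8 * X ^ 2 + 157696 * A ^ 3 * B ^ 11 * X ^ 3 + 16384 * B ^ 14 * X ^ 4)) ?_).1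
  rw [overSeries_dissection, ← hA, ← hB]
  simp only [map_add, map_mul, map_pow, map_ofNat, expand_X]
  ring

theorem tri_overSeries_pow_eight {A B : ℤ⟦X⟧}
    (hA : A = PowerSeries.expand 3 (by norm_num) (theta 1 0)) (hB : B = theta 3 2) (c : ℤ⟦X⟧) :
    tri 0 (PowerSeries.expand 3 (by norm_num) c * overSeries ^ 8) =
      c * cubicQuot ^ 8 * (A ^ 16 + 896 * A ^ 13 * B ^ 3 * X + 50176 * A ^ 10 * B ^ 6 * X ^ 2 +
        520192 * A ^ 7 * B ^ 9 * X ^ 3 + 1089536 * A ^ 4 * B ^ 12 * X ^ 4 + 262144 * A * B ^ 15 * X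
        ^ 5) := by
  refine (tri_sum
    (b := c * cubicQuot ^ 8 * (16 * A ^ 15 * B + 4256 * A ^ 12 * B ^ 4 * X + 130048 * A ^ 9 * B ^
      7 * X ^ 2 + 802816 * A ^ 6 * B ^ 10 * X ^ 3 + 917504 * A ^ 3 * B ^ 13 * X ^ 4 + 65536 * B ^ 16
      * X ^ 5))
    (c := c * cubicQuot ^ 8 * (144 * A ^ 14 * B ^ 2 + 16128 * A ^ 11 * B ^ 5 * X + 283392 * A ^ 8
      * B ^ 8 * X ^ 2 + 1032192 * A ^ 5 * B ^ 11 * X ^ 3 + 589824 * A ^ 2 * B ^ 14 * X ^ 4)) ?_).1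
  rw [overSeries_dissection, ← hA, ← hB]
  simp only [map_add, map_mul, map_pow, map_ofNat, expand_X]
  ring

/-! ### The congruences and their iteration -/

theorem tri_cube_congruences :
    (∃ h, tri 0 (overSeries ^ 3) = cubicQuot + 72 * h) ∧
    (∃ h, tri 1 (overSeries ^ 3) = 6 * (PowerSeries.expand 3 (by norm_num) (theta 1 0) ^ 4 *
      overSeries ^ 8) * theta 3 2 + 144 * h) ∧
    (∃ h, tri 2 (overSeries ^ 3) = 24 * (PowerSeries.expand 3 (by norm_num) (theta 1 0) ^ 3 *
      overSeries ^ 8) * theta 3 2 ^ 2 + 288 * h) := by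
  have hD := disc_mul_cubicQuot
  obtain ⟨h0, h1, h2⟩ := tri_overSeries_pow_three rfl rfl 1
  rw [map_one, one_mul, one_mul] at h0 h1 h2
  have hK : cubicQuot = PowerSeries.expand 3 (by norm_num) (theta 1 0) * overSeries ^ 4 := rfl
  rw [h0, h1, h2]
  generalize PowerSeries.expand 3 _ (theta 1 0) = A at *
  generalize theta 3 2 = B at *
  generalize cubicQuot = K at *
  generalize overSeries = v at *
  -- The witnesses are the errors in replacing the three polynomials by D², 6A²B·D and 24AB²·D,
  -- where D = A³ - 8XB³, divided by 72, 144 and 288.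
  refine ⟨⟨K ^ 3 * (A ^ 3 * B ^ 3 * X), ?_⟩, ⟨K ^ 3 * (X * A ^ 2 * B ^ 4), ?_⟩,
    ⟨K ^ 3 * (X * A * B ^ 5), ?_⟩⟩
  · linear_combination K * ((A ^ 3 - 8 * X * B ^ 3) * K + 1) * hD
  · linear_combination 6 * K ^ 2 * A ^ 2 * B * hD + 6 * A ^ 2 * B * (K + A * v ^ 4) * hK
  · linear_combination 24 * K ^ 2 * A * B ^ 2 * hD + 24 * A * B ^ 2 * (K + A * v ^ 4) * hK

theorem tri_cubicQuot :
    ∃ h, tri 0 cubicQuot =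
      PowerSeries.expand 3 (by norm_num) (theta 1 0) ^ 4 * overSeries ^ 7 + 72 * h := by
  have hD := disc_mul_cubicQuot
  have hv := overSeries_mul_theta
  have h0 := tri_overSeries_pow_four rfl rfl (theta 1 0)
  have hK : cubicQuot = PowerSeries.expand 3 (by norm_num) (theta 1 0) * overSeries ^ 4 := rfl
  rw [← hK] at h0
  rw [h0]
  generalize PowerSeries.expand 3 _ (theta 1 0) = A at *
  generalize theta 1 0 = g at *
  generalize theta 3 2 = B at *
  generalize cubicQuot = K at *
  generalize overSeries = v at *
  -- The polynomial is A²D² modulo 72, leaving gK²A² = gA⁴v⁸ = A⁴v⁷.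
  refine ⟨g * K ^ 4 * (2 * A ^ 5 * B ^ 3 * X + 8 * A ^ 2 * B ^ 6 * X ^ 2), ?_⟩
  linear_combination g * K ^ 2 * A ^ 2 * ((A ^ 3 - 8 * X * B ^ 3) * K + 1) * hD +
    g * A ^ 2 * (K + A * v ^ 4) * hK + A ^ 4 * v ^ 7 * hv

theorem tri_even_step :
    ∃ h, tri 0 (PowerSeries.expand 3 (by norm_num) (theta 1 0) ^ 4 * overSeries ^ 7) =
      PowerSeries.expand 3 (by norm_num) (theta 1 0) ^ 5 * overSeries ^ 8 + 72 * h := by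
  have hD := disc_mul_cubicQuot
  have hv := overSeries_mul_theta
  have h0 := tri_overSeries_pow_seven rfl rfl (theta 1 0 ^ 4)
  have hK : cubicQuot = PowerSeries.expand 3 (by norm_num) (theta 1 0) * overSeries ^ 4 := rfl
  rw [map_pow] at h0
  rw [h0]
  generalize PowerSeries.expand 3 _ (theta 1 0) = A at *
  generalize theta 1 0 = g at *
  generalize theta 3 2 = B at *
  generalize cubicQuot = K at *
  generalize overSeries = v at *
  refine ⟨g ^ 4 * K ^ 7 * (9 * A ^ 11 * B ^ 3 * X + 312 * A ^ 8 * B ^ 6 * X ^ 2 +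
    1920 * A ^ 5 * B ^ 9 * X ^ 3 + 1536 * A ^ 2 * B ^ 12 * X ^ 4), ?_⟩
  -- The polynomial is A²D⁴ modulo 72, leaving g⁴K³A² = g⁴A⁵v¹² = A⁵v⁸.
  have hD4 : ((A ^ 3 - 8 * X * B ^ 3) * K) ^ 4 = 1 := by rw [hD, one_pow]
  have hv4 : (v * g) ^ 4 = 1 := by rw [hv, one_pow]
  linear_combination g ^ 4 * K ^ 3 * A ^ 2 * hD4 +
    g ^ 4 * A ^ 2 * (K ^ 2 + K * (A * v ^ 4) + (A * v ^ 4) ^ 2) * hK + A ^ 5 * v ^ 8 * hv4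

theorem tri_odd_step :
    ∃ h, tri 0 (PowerSeries.expand 3 (by norm_num) (theta 1 0) ^ 5 * overSeries ^ 8) =
      PowerSeries.expand 3 (by norm_num) (theta 1 0) ^ 4 * overSeries ^ 7 + 72 * h := by
  have hD := disc_mul_cubicQuot
  have hv := overSeries_mul_theta
  have h0 := tri_overSeries_pow_eight rfl rfl (theta 1 0 ^ 5)
  have hK : cubicQuot = PowerSeries.expand 3 (by norm_num) (theta 1 0) * overSeries ^ 4 := rfl
  rw [map_pow] at h0
  rw [h0]
  generalize PowerSeries.expand 3 _ (theta 1 0) = A at *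
  generalize theta 1 0 = g at *
  generalize theta 3 2 = B at *
  generalize cubicQuot = K at *
  generalize overSeries = v at *
  refine ⟨g ^ 5 * K ^ 8 * (13 * A ^ 13 * B ^ 3 * X + 688 * A ^ 10 * B ^ 6 * X ^ 2 +
    7296 * A ^ 7 * B ^ 9 * X ^ 3 + 14848 * A ^ 4 * B ^ 12 * X ^ 4 +
    4096 * A * B ^ 15 * X ^ 5), ?_⟩
  -- The polynomial is A·D⁵ modulo 72, leaving g⁵K³A = g⁵A⁴v¹² = A⁴v⁷, which closes the cycle.
  have hD5 : ((A ^ 3 - 8 * X * B ^ 3) * K) ^ 5 = 1 := by rw [hD, one_pow]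
  have hv5 : (v * g) ^ 5 = 1 := by rw [hv, one_pow]
  linear_combination g ^ 5 * K ^ 3 * A * hD5 +
    g ^ 5 * A * (K ^ 2 + K * (A * v ^ 4) + (A * v ^ 4) ^ 2) * hK + A ^ 4 * v ^ 7 * hv5

theorem tri_congr {f g : ℤ⟦X⟧} (r : ℕ) (m : ℕ) (h : ∃ e, f = g + (m : ℤ⟦X⟧) * e) :
    ∃ e, tri r f = tri r g + (m : ℤ⟦X⟧) * e := by
  obtain ⟨e, rfl⟩ := h
  refine ⟨tri r e, ?_⟩
  rw [map_add, ← nsmul_eq_mul, map_nsmul, nsmul_eq_mul]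

theorem tri_pbar (j r : ℕ) :
    tri r (PowerSeries.mk fun n => (pbar 3 (3 ^ j * n) : ℤ)) =
      PowerSeries.mk fun n => (pbar 3 (3 ^ j * (3 * n + r)) : ℤ) := by
  ext n
  simp [coeff_tri]

theorem tri_zero_pbar (j : ℕ) :
    tri 0 (PowerSeries.mk fun n => (pbar 3 (3 ^ j * n) : ℤ)) =
      PowerSeries.mk fun n => (pbar 3 (3 ^ (j + 1) * n) : ℤ) := by
  rw [tri_pbar]
  simp only [add_zero, pow_succ, mul_assoc]

theorem pbar_pow_three_congruences (α : ℕ) :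
    (∃ h, (PowerSeries.mk fun n => (pbar 3 (3 ^ (2 * (α + 1)) * n) : ℤ)) =
      PowerSeries.expand 3 (by norm_num) (theta 1 0) ^ 4 * overSeries ^ 7 + (72 : ℕ) * h) ∧
    ∃ h, (PowerSeries.mk fun n => (pbar 3 (3 ^ (2 * (α + 1) + 1) * n) : ℤ)) =
      PowerSeries.expand 3 (by norm_num) (theta 1 0) ^ 5 * overSeries ^ 8 + (72 : ℕ) * h := by
  have trans : ∀ f g k : ℤ⟦X⟧, (∃ h, f = g + (72 : ℕ) * h) → (∃ h, g = k + 72 * h) →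
      ∃ h, f = k + (72 : ℕ) * h := by
    rintro f g k ⟨h, rfl⟩ ⟨h', rfl⟩
    exact ⟨h' + h, by push_cast; ring⟩
  have step : ∀ j (f k : ℤ⟦X⟧),
      (∃ h, (PowerSeries.mk fun n => (pbar 3 (3 ^ j * n) : ℤ)) = f + (72 : ℕ) * h) →
      (∃ h, tri 0 f = k + 72 * h) →
      ∃ h, (PowerSeries.mk fun n => (pbar 3 (3 ^ (j + 1) * n) : ℤ)) = k + (72 : ℕ) * h := by
    intro j f k h1 h2
    rw [← tri_zero_pbar]
    exact trans _ _ _ (tri_congr 0 72 h1) h2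
  have main : ∃ h, (PowerSeries.mk fun n => (pbar 3 (3 ^ (2 * (α + 1)) * n) : ℤ)) =
      PowerSeries.expand 3 (by norm_num) (theta 1 0) ^ 4 * overSeries ^ 7 + (72 : ℕ) * h := by
    induction α with
    | zero =>
      -- Two sections lead from v³ through K to A⁴v⁷, where the two-step cycle begins.
      refine step 1 _ _ (step 0 (overSeries ^ 3) _ ⟨0, ?_⟩ tri_cube_congruences.1) tri_cubicQuot
      simp [← mk_pbar_eq]
    | succ α ih => exact step _ _ _ (step _ _ _ ih tri_even_step) tri_odd_step
  exact ⟨main, step _ _ _ main tri_even_step⟩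

/-! ### The substitution of -q for q -/

theorem altSeries_eq (a : ℕ → ℕ) :
    altSeries a = substNeg (PowerSeries.mk fun n => (a n : ℤ)) := by
  ext n
  simp [altSeries, substNeg, coeff_rescale]

theorem seriesModEq_substNeg {f g : ℤ⟦X⟧} {m : ℕ} (h : ∃ e, f = g + (m : ℤ⟦X⟧) * e) :
    SeriesModEq m (substNeg f) (substNeg g) := by
  obtain ⟨e, rfl⟩ := h
  intro n
  have : ((m : ℤ⟦X⟧) * e) = C (m : ℤ) * e := by simp
  rw [this, substNeg, substNeg, coeff_rescale, coeff_rescale, map_add, coeff_C_mul]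
  refine (Int.modEq_iff_dvd.2 ⟨-((-1) ^ n * coeff n e), ?_⟩)
  ring

theorem seriesDiv_phi_pow (a k : ℕ) :
    seriesDiv (substPow 3 three_ne_zero phi ^ a) (phi ^ k) =
      substNeg (PowerSeries.expand 3 (by norm_num) (theta 1 0) ^ a * overSeries ^ k) := by
  have h := seriesDiv_mul_cancel (substPow 3 three_ne_zero phi ^ a) (phi ^ k)
    (by rw [map_pow, constantCoeff_phi, one_pow])
  have hv : substNeg overSeries * phi = 1 := by
    rw [← substNeg_theta, substNeg, substNeg, ← map_mul, overSeries_mul_theta, map_one]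
  have hk : substNeg overSeries ^ k * phi ^ k = 1 := by rw [← mul_pow, hv, one_pow]
  have ha : substNeg (PowerSeries.expand 3 (by norm_num) (theta 1 0)) =
      substPow 3 three_ne_zero phi := by
    rw [substNeg_expand_three, substNeg_theta]
  have : substNeg (PowerSeries.expand 3 (by norm_num) (theta 1 0) ^ a * overSeries ^ k) =
      substPow 3 three_ne_zero phi ^ a * substNeg overSeries ^ k := by
    rw [← ha]
    simp only [substNeg, map_mul, map_pow]
  rw [this]
  linear_combination substNeg overSeries ^ k * h -
    seriesDiv (substPow 3 three_ne_zero phi ^ a) (phi ^ k) * hk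

end OverpartitionTriples

open OverpartitionTriples
theorem mainTheorem11 :
    -- the three dissections
    (SeriesModEq (9 * 2 ^ 3)
      (altSeries fun n => pbar 3 (3 * n))
      (seriesDiv
        (substPow 3 three_ne_zero phi)
        (phi ^ 4))) ∧
    (SeriesModEq (9 * 2 ^ 4)
      (altSeries fun n => pbar 3 (3 * n + 1))
      (6 * seriesDiv
        (substPow 3 three_ne_zero phi ^ 4)
        (phi ^ 8) *
        substNeg seriesB)) ∧
    (SeriesModEq (9 * 2 ^ 5)
      (altSeries fun n => pbar 3 (3 * n + 2))
      (24 * seriesDiv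
        (substPow 3 three_ne_zero phi ^ 3)
        (phi ^ 8) *
        substNeg seriesB ^ 2)) ∧
    -- the infinite families
    (∀ α : ℕ, 1 ≤ α →
      SeriesModEq (9 * 2 ^ 3)
        (altSeries fun n => pbar 3 (3 ^ (2 * α) * n))
        (seriesDiv
          (substPow 3 three_ne_zero phi ^ 4)
          (phi ^ 7)) ∧
      SeriesModEq (9 * 2 ^ 3)
        (altSeries fun n => pbar 3 (3 ^ (2 * α + 1) * n))
        (seriesDiv
          (substPow 3 three_ne_zero phi ^ 5)
          (phi ^ 8))) := by
  have hs : ∀ r, (PowerSeries.mk fun n => (pbar 3 (3 * n + r) : ℤ)) = tri r (overSeries ^ 3) := by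
    intro r
    rw [← mk_pbar_eq]
    simpa using (tri_pbar 0 r).symm
  obtain ⟨h0, h1, h2⟩ := tri_cube_congruences
  have hneg : ∀ (c : ℕ) (f g : ℤ⟦X⟧), (c : ℤ⟦X⟧) * substNeg f * substNeg g =
      substNeg ((c : ℤ⟦X⟧) * f * g) := by
    intro c f g
    simp only [substNeg, map_mul, map_natCast]
  refine ⟨?_, ?_, ?_, ?_⟩
  · have h := seriesDiv_phi_pow 1 4
    rw [pow_one, pow_one] at h
    rw [h, altSeries_eq, show (9 * 2 ^ 3 : ℤ) = (72 : ℕ) by norm_num]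
    exact seriesModEq_substNeg ((hs 0).trans h0.choose_spec |> fun e => ⟨_, e⟩)
  · rw [seriesDiv_phi_pow, seriesB_eq_theta, altSeries_eq,
      show (9 * 2 ^ 4 : ℤ) = (144 : ℕ) by norm_num]
    have := hneg 6 (PowerSeries.expand 3 (by norm_num) (theta 1 0) ^ 4 * overSeries ^ 8) (theta 3 2)
    rw [Nat.cast_ofNat] at this
    rw [this, hs]
    exact seriesModEq_substNeg h1
  · rw [seriesDiv_phi_pow, seriesB_eq_theta, altSeries_eq,
      show (9 * 2 ^ 5 : ℤ) = (288 : ℕ) by norm_num]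
    have := hneg 24 (PowerSeries.expand 3 (by norm_num) (theta 1 0) ^ 3 * overSeries ^ 8)
      (theta 3 2 ^ 2)
    rw [Nat.cast_ofNat] at this
    rw [show substNeg (theta 3 2) ^ 2 = substNeg (theta 3 2 ^ 2) by simp only [substNeg, map_pow],
      this, hs]
    exact seriesModEq_substNeg h2
  · intro α hα
    obtain ⟨β, rfl⟩ : ∃ β, α = β + 1 := ⟨α - 1, by omega⟩
    obtain ⟨e1, e2⟩ := pbar_pow_three_congruences β
    rw [seriesDiv_phi_pow, seriesDiv_phi_pow, altSeries_eq, altSeries_eq,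
      show (9 * 2 ^ 3 : ℤ) = (72 : ℕ) by norm_num]
    exact ⟨seriesModEq_substNeg e1, seriesModEq_substNeg e2⟩
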